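/- Let $\mathbb H$ be the quaternions, identified with $\mathbb R^4$ through the basis $1,i,j,k$, and let $\delta=\operatorname{diag}(1,-1)$. Let $Sp(1,1)$ be the group of invertible quaternionic $2\times 2$ matrices $g$ with $\overline g^{T}\delta g=\delta$, and $$sp(1,1)=\{X\in\mathbb H^{2\times 2}\mid \overline X^{T}\delta+\delta X=0\}=\left\{\begin{pmatrix}\xi&\overline\alpha\\ \alpha&\eta\end{pmatrix}\;\middle|\;\alpha\in\mathbb H,\ \xi,\eta\in\operatorname{Im}\mathbb H\right\}$$ its Lie algebra. Let $O_o(1,4)$ be the identity component of the group $O(1,4)$ of real $5\times5$ matrices preserving $x_0^2-|x|^2$, $(x_0,x)\in\mathbb R\times\mathbb R^4$, and $o(1,4)$ its Lie algebra. Let $Sp_1$ be the group of unit quaternions and $S^3$ the unit sphere of $\mathbb R^4$. Consider - the Möbius action of $Sp(1,1)$ on $Sp_1$: $\begin{pmatrix}A&B\\C&D\end{pmatrix}\ast u=(Au+B)(Cu+D)^{-1}$; - the conformal action of $O_o(1,4)$ on $S^3$: $A\ast_c z=z'$, the unique $z'\in S^3$ with $A(1,z)^T\in\mathbb R(1,z')^T$;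 - $\rho:Sp_1\to S^3$, $\rho(u)=\overline u$. Let $L_\eta(q)=\eta q$ and $R_\xi(q)=q\xi$. Then the map $$f:sp(1,1)\to o(1,4),\qquad f\begin{pmatrix}\xi&\overline\alpha\\ \alpha&\eta\end{pmatrix}=\begin{pmatrix}0&2\alpha^T\\2\alpha&L_\eta-R_\xi\end{pmatrix},$$ is an isomorphism of real Lie algebras, there is exactly one continuous group morphism $F:Sp(1,1)\to O_o(1,4)$ whose differential at the identity is $f$, and for this $F$ $$F(g)\ast_c\rho(u)=\rho(g\ast u)\qquad\text{for all } g\in Sp(1,1),\ u\in Sp_1 .$$ -/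

import Mathlib

open scoped Quaternion Matrix

attribute [local instance 100] LieRing.ofAssociativeRing

noncomputable section

namespace SpinConf

/-- The matrix `diag(1, -1)` of the Hermitian form `x̄ ξ - ȳ η` on the right quaternionic vector
space `ℍ²`. -/
def delta : Matrix (Fin 2) (Fin 2) ℍ[ℝ] := Matrix.diagonal ![1, -1]

/-- The group `Sp(1,1)` of invertible quaternionic `2 × 2` matrices `g` with `gᴴ δ g = δ`, with the
topology of a subgroup of the invertible matrices. -/
def Sp11 : Subgroup (Matrix (Fin 2) (Fin 2) ℍ[ℝ])ˣ where
  carrier := {g | (g : Matrix (Fin 2) (Fin 2) ℍ[ℝ])ᴴ * delta *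
    (g : Matrix (Fin 2) (Fin 2) ℍ[ℝ]) = delta}
  one_mem' := by simp
  mul_mem' := by
    intro g h hg hh
    simp only [Set.mem_ofPred_eq, Units.val_mul, Matrix.conjTranspose_mul] at *
    calc _ = (h.1)ᴴ * ((g.1)ᴴ * delta * g.1) * h.1 := by simp only [mul_assoc]
      _ = _ := by rw [hg, hh]
  inv_mem' := by
    intro g hg
    simp only [Set.mem_ofPred_eq] at *
    have h1 : g.1 * (g⁻¹).1 = 1 := by simp
    have h2 : ((g⁻¹).1)ᴴ * (g.1)ᴴ = 1 := by
      rw [← Matrix.conjTranspose_mul, h1, Matrix.conjTranspose_one]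
    calc _ = ((g⁻¹).1)ᴴ * ((g.1)ᴴ * delta * g.1) * (g⁻¹).1 := by rw [hg]
      _ = (((g⁻¹).1)ᴴ * (g.1)ᴴ) * delta * (g.1 * (g⁻¹).1) := by simp only [mul_assoc]
      _ = _ := by rw [h1, h2, one_mul, mul_one]

/-- The real Lie algebra `sp(1,1)` of quaternionic `2 × 2` matrices `X` with
`Xᴴ δ + δ X = 0`, that is, `X = (ξ, ᾱ; α, η)` with `ξ, η` imaginary, with the commutator bracket. -/
def sp11 : LieSubalgebra ℝ (Matrix (Fin 2) (Fin 2) ℍ[ℝ]) where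
  carrier := {X | Xᴴ * delta + delta * X = 0}
  zero_mem' := by simp
  add_mem' := by
    intro X Y hX hY
    simp only [Set.mem_ofPred_eq, Matrix.conjTranspose_add, add_mul, mul_add] at *
    rw [add_add_add_comm, hX, hY, add_zero]
  smul_mem' := by
    intro c X hX
    simp only [Set.mem_ofPred_eq] at *
    have h : (c • X)ᴴ = c • Xᴴ := by
      refine Matrix.ext fun i j => ?_
      simp [Matrix.conjTranspose_apply, Quaternion.star_smul]
    rw [h, smul_mul_assoc, mul_smul_comm, ← smul_add, hX,
      smul_zero]
  lie_mem' := by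
    intro X Y hX hY
    simp only [Set.mem_ofPred_eq] at *
    have h1 : Xᴴ * delta = -(delta * X) := eq_neg_of_add_eq_zero_left hX
    have h2 : Yᴴ * delta = -(delta * Y) := eq_neg_of_add_eq_zero_left hY
    rw [Ring.lie_def, Matrix.conjTranspose_sub, Matrix.conjTranspose_mul,
      Matrix.conjTranspose_mul, sub_mul, mul_assoc, mul_assoc, h1, h2, mul_neg, mul_neg,
      ← mul_assoc, ← mul_assoc, h1, h2]
    noncomm_ring

/-- The matrix `(ξ, ᾱ; α, η)` lies in `sp(1,1)` exactly for its imaginary `ξ` and `η`. -/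
theorem mem_sp11_iff (X : Matrix (Fin 2) (Fin 2) ℍ[ℝ]) :
    X ∈ sp11 ↔ (X 0 0).re = 0 ∧ (X 1 1).re = 0 ∧ X 0 1 = star (X 1 0) := by
  change Xᴴ * delta + delta * X = 0 ↔ _
  rw [← Matrix.ext_iff]
  simp only [Fin.forall_fin_two, delta, Matrix.add_apply,
    Matrix.diagonal_mul, Matrix.zero_apply, Matrix.cons_val_zero, Matrix.cons_val_one, one_mul,
    neg_mul]
  simp only [Quaternion.ext_iff]
  simp
  grind

/-- The group `O(1,4)` of invertible real matrices, with rows and columns indexed by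
`Fin 1 ⊕ Fin 4`, preserving the quadratic form `x₀² - |x|²`. -/
def O14 : Subgroup (Matrix (Fin 1 ⊕ Fin 4) (Fin 1 ⊕ Fin 4) ℝ)ˣ where
  carrier := {A | (A : Matrix (Fin 1 ⊕ Fin 4) (Fin 1 ⊕ Fin 4) ℝ)ᵀ *
    LieAlgebra.Orthogonal.indefiniteDiagonal (Fin 1) (Fin 4) ℝ *
    (A : Matrix (Fin 1 ⊕ Fin 4) (Fin 1 ⊕ Fin 4) ℝ) =
      LieAlgebra.Orthogonal.indefiniteDiagonal (Fin 1) (Fin 4) ℝ}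
  one_mem' := by simp
  mul_mem' := by
    intro g h hg hh
    simp only [Set.mem_ofPred_eq, Units.val_mul, Matrix.transpose_mul] at *
    calc _ = (h.1)ᵀ * ((g.1)ᵀ * LieAlgebra.Orthogonal.indefiniteDiagonal (Fin 1) (Fin 4) ℝ *
              g.1) * h.1 := by simp only [mul_assoc]
      _ = _ := by rw [hg, hh]
  inv_mem' := by
    intro g hg
    simp only [Set.mem_ofPred_eq] at *
    have h1 : g.1 * (g⁻¹).1 = 1 := by simp
    have h2 : ((g⁻¹).1)ᵀ * (g.1)ᵀ = 1 := by
      rw [← Matrix.transpose_mul, h1, Matrix.transpose_one]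
    calc _ = ((g⁻¹).1)ᵀ * ((g.1)ᵀ * LieAlgebra.Orthogonal.indefiniteDiagonal (Fin 1) (Fin 4) ℝ *
              g.1) * (g⁻¹).1 := by rw [hg]
      _ = (((g⁻¹).1)ᵀ * (g.1)ᵀ) * LieAlgebra.Orthogonal.indefiniteDiagonal (Fin 1) (Fin 4) ℝ *
              (g.1 * (g⁻¹).1) := by simp only [mul_assoc]
      _ = _ := by rw [h1, h2, one_mul, mul_one]

/-- `O_o(1,4)`: the identity component of `O(1,4)`. -/
abbrev Oo14 : Subgroup O14 := Subgroup.connectedComponentOfOne O14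

/-- The Lie algebra `o(1,4)` of the group `O(1,4)`. -/
abbrev o14 : LieSubalgebra ℝ (Matrix (Fin 1 ⊕ Fin 4) (Fin 1 ⊕ Fin 4) ℝ) :=
  LieAlgebra.Orthogonal.so' (Fin 1) (Fin 4) ℝ

/-- The coordinates `(a, b, c, d)` of the quaternion `a + bi + cj + dk`. -/
def coords (q : ℍ[ℝ]) : Fin 4 → ℝ := ![q.re, q.imI, q.imJ, q.imK]

/-- The basis `1, i, j, k` of `ℍ`. -/
def unitQ : Fin 4 → ℍ[ℝ] := ![⟨1, 0, 0, 0⟩, ⟨0, 1, 0, 0⟩, ⟨0, 0, 1, 0⟩, ⟨0, 0, 0, 1⟩]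

/-- A quaternion as a column vector. -/
def col (q : ℍ[ℝ]) : Matrix (Fin 4) (Fin 1) ℝ := Matrix.of fun i _ => coords q i

/-- The matrix, in the basis `1, i, j, k` of `ℍ`, of the real linear map
`L_η - R_ξ : q ↦ η q - q ξ`: its column `j` is the image of the basis element `j`. -/
def leftSubRight (η ξ : ℍ[ℝ]) : Matrix (Fin 4) (Fin 4) ℝ :=
  Matrix.of fun i j => coords (η * unitQ j - unitQ j * ξ) i

/-- The assignment `(ξ, ᾱ; α, η) ↦ (0, 2αᵀ; 2α, L_η - R_ξ)`. -/
def fMatrix (X : Matrix (Fin 2) (Fin 2) ℍ[ℝ]) :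
    Matrix (Fin 1 ⊕ Fin 4) (Fin 1 ⊕ Fin 4) ℝ :=
  Matrix.fromBlocks 0 ((2 : ℝ) • (col (X 1 0))ᵀ) ((2 : ℝ) • col (X 1 0))
    (leftSubRight (X 1 1) (X 0 0))

/-- `dF₁ = f`: the map `F` sends every curve in `Sp(1,1)` through the identity, with velocity `X`
there, to a curve with velocity `f X`. Derivatives of curves of matrices are taken entrywise. -/
def HasDifferentialAtOne (F : Sp11 → Oo14) (f : sp11 → o14) : Prop :=
  ∀ (γ : ℝ → Sp11) (X : sp11), γ 0 = 1 →
    (∀ i j, HasDerivAt (fun t => ((γ t : (Matrix (Fin 2) (Fin 2) ℍ[ℝ])ˣ) :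
      Matrix (Fin 2) (Fin 2) ℍ[ℝ]) i j) ((X : Matrix (Fin 2) (Fin 2) ℍ[ℝ]) i j) 0) →
    ∀ i j, HasDerivAt (fun t => (((F (γ t) : O14) :
      (Matrix (Fin 1 ⊕ Fin 4) (Fin 1 ⊕ Fin 4) ℝ)ˣ) :
      Matrix (Fin 1 ⊕ Fin 4) (Fin 1 ⊕ Fin 4) ℝ) i j)
      ((f X : Matrix (Fin 1 ⊕ Fin 4) (Fin 1 ⊕ Fin 4) ℝ) i j) 0

/-- The Lie group morphism `F : Sp(1,1) → O_o(1,4)` is induced by (integrates) `f`. -/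
def Integrates (F : Sp11 →* Oo14) (f : sp11 → o14) : Prop :=
  Continuous F ∧ HasDifferentialAtOne F f

/-- `Sp₁`, the group of quaternions `u` with `ū u = u ū = 1`. -/
abbrev Sp1 : Submonoid ℍ[ℝ] := unitary ℍ[ℝ]

/-- The unit sphere `S³` of `ℝ⁴`. -/
abbrev S3 : Set (EuclideanSpace ℝ (Fin 4)) := Metric.sphere (0 : EuclideanSpace ℝ (Fin 4)) 1

theorem norm_eq_one_of_mem_Sp1 (u : Sp1) : ‖(u : ℍ[ℝ])‖ = 1 := by
  have h := Quaternion.normSq_eq_norm_mul_self (u : ℍ[ℝ])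
  have h2 : ((Quaternion.normSq (u : ℍ[ℝ]) : ℝ) : ℍ[ℝ]) = 1 := by
    rw [← Quaternion.star_mul_self, Unitary.coe_star_mul_self]
  have h3 : Quaternion.normSq (u : ℍ[ℝ]) = 1 := by exact Quaternion.coe_injective (by rw [h2, Quaternion.coe_one])
  nlinarith [norm_nonneg (u : ℍ[ℝ])]

theorem mem_Sp1_of_norm_eq_one {q : ℍ[ℝ]} (h : ‖q‖ = 1) : q ∈ Sp1 := by
  rw [Unitary.mem_iff, Quaternion.star_mul_self, Quaternion.self_mul_star,
    Quaternion.normSq_eq_norm_mul_self, h]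
  simp

/-- `ρ(u) = ū`, under the canonical identification of `ℍ` with `ℝ⁴`. -/
def rho (u : Sp1) : S3 :=
  ⟨Quaternion.linearIsometryEquivTuple (star (u : ℍ[ℝ])), by
    rw [mem_sphere_zero_iff_norm, LinearIsometryEquiv.norm_map, norm_star,
      norm_eq_one_of_mem_Sp1]⟩

/-- The numerator `A u + B` of the Möbius action. -/
def mobNum (g : Sp11) (u : Sp1) : ℍ[ℝ] :=
  g.1.1 0 0 * (u : ℍ[ℝ]) + g.1.1 0 1

/-- The denominator `C u + D` of the Möbius action. -/
def mobDen (g : Sp11) (u : Sp1) : ℍ[ℝ] :=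
  g.1.1 1 0 * (u : ℍ[ℝ]) + g.1.1 1 1

theorem norm_mobNum (g : Sp11) (u : Sp1) : ‖mobNum g u‖ = ‖mobDen g u‖ := by
  have hg : (g.1.1)ᴴ * delta * g.1.1 = delta := g.2
  have hu : star (u : ℍ[ℝ]) * (u : ℍ[ℝ]) = 1 := Unitary.coe_star_mul_self u
  have e := fun i j => congrFun (congrFun hg i) j
  simp only [Matrix.mul_apply, Fin.sum_univ_two, delta,
    Matrix.conjTranspose_apply, Matrix.diagonal_apply] at e
  have e00 := e 0 0
  have e01 := e 0 1
  have e10 := e 1 0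
  have e11 := e 1 1
  simp at e00 e01 e10 e11
  have key : star (mobNum g u) * mobNum g u = star (mobDen g u) * mobDen g u := by
    unfold mobNum mobDen
    generalize g.1.1 0 0 = a at *
    generalize g.1.1 0 1 = b at *
    generalize g.1.1 1 0 = c at *
    generalize g.1.1 1 1 = d at *
    generalize (u : ℍ[ℝ]) = v at *
    rw [← sub_eq_zero]
    calc _ = star v * (star a * a + -(star c * c)) * v
          + star v * (star a * b + -(star c * d))
          + (star b * a + -(star d * c)) * v + (star b * b + -(star d * d)) := by
            simp only [star_add, star_mul]
            noncomm_ring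
      _ = 0 := by rw [e00, e01, e10, e11]; simp [hu]
  rw [Quaternion.star_mul_self, Quaternion.star_mul_self, Quaternion.coe_inj,
    Quaternion.normSq_eq_norm_mul_self, Quaternion.normSq_eq_norm_mul_self] at key
  exact (mul_self_inj (norm_nonneg _) (norm_nonneg _)).1 key

theorem mobDen_ne_zero (g : Sp11) (u : Sp1) : mobDen g u ≠ 0 := by
  intro h0
  have h1 : mobNum g u = 0 := by
    rw [← norm_eq_zero, norm_mobNum, h0, norm_zero]
  have hi : (g.1⁻¹).1 * g.1.1 = 1 := by simp
  have e0 := congrFun (congrFun hi 1) 0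
  have e1 := congrFun (congrFun hi 1) 1
  simp only [Matrix.mul_apply, Fin.sum_univ_two] at e0 e1
  have : (g.1⁻¹).1 1 0 * mobNum g u + (g.1⁻¹).1 1 1 * mobDen g u = 1 := by
    unfold mobNum mobDen
    calc _ = ((g.1⁻¹).1 1 0 * g.1.1 0 0 + (g.1⁻¹).1 1 1 * g.1.1 1 0) * (u : ℍ[ℝ])
          + ((g.1⁻¹).1 1 0 * g.1.1 0 1 + (g.1⁻¹).1 1 1 * g.1.1 1 1) := by
            noncomm_ring
      _ = 1 := by rw [e0, e1]; simp
  rw [h0, h1] at this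
  simp at this

/-- The Möbius action `(A, B; C, D) ∗ u = (A u + B) (C u + D)⁻¹` of `Sp(1,1)` on `Sp₁`. -/
def mobiusAct (g : Sp11) (u : Sp1) : Sp1 :=
  ⟨mobNum g u * (mobDen g u)⁻¹, mem_Sp1_of_norm_eq_one (by
    rw [norm_mul, norm_inv, norm_mobNum, mul_inv_cancel₀]
    exact norm_ne_zero_iff.2 (mobDen_ne_zero g u))⟩

/-- The vector `(1, z)` of `ℝ^{1+4}`. -/
def lightVec (z : S3) : Fin 1 ⊕ Fin 4 → ℝ :=
  Sum.elim (fun _ => 1) (fun i => (z : EuclideanSpace ℝ (Fin 4)) i)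

theorem sum_sq_S3 (z : S3) : ∑ i, ((z : EuclideanSpace ℝ (Fin 4)) i) ^ 2 = 1 := by
  have h := mem_sphere_zero_iff_norm.1 z.2
  rw [← EuclideanSpace.real_norm_sq_eq, h, one_pow]

theorem sum_sq_mulVec (A : O14) (z : S3) :
    ∑ i, (A.1.1 *ᵥ lightVec z) (Sum.inr i) ^ 2 = (A.1.1 *ᵥ lightVec z) (Sum.inl 0) ^ 2 := by
  have hA : (A.1.1)ᵀ * LieAlgebra.Orthogonal.indefiniteDiagonal (Fin 1) (Fin 4) ℝ * A.1.1 =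
    LieAlgebra.Orthogonal.indefiniteDiagonal (Fin 1) (Fin 4) ℝ := A.2
  have q : ∀ v : Fin 1 ⊕ Fin 4 → ℝ,
      v ⬝ᵥ (LieAlgebra.Orthogonal.indefiniteDiagonal (Fin 1) (Fin 4) ℝ *ᵥ v) =
      v (Sum.inl 0) ^ 2 - ∑ i, v (Sum.inr i) ^ 2 := by
    intro v
    simp only [LieAlgebra.Orthogonal.indefiniteDiagonal, dotProduct, Matrix.mulVec_diagonal,
      Fintype.sum_sum_type, Sum.elim_inl, Sum.elim_inr, Fin.sum_univ_succ, Fin.sum_univ_zero]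
    simp
    ring
  have h1 := q (A.1.1 *ᵥ lightVec z)
  have h2 := q (lightVec z)
  rw [Matrix.dotProduct_mulVec, Matrix.vecMul_mulVec, ← Matrix.dotProduct_mulVec,
    Matrix.mulVec_mulVec, hA, h2] at h1
  have h3 := sum_sq_S3 z
  simp only [lightVec, Sum.elim_inl, Sum.elim_inr] at h1 h3
  rw [h3] at h1
  simp only [lightVec]
  linarith

theorem mulVec_lightVec_ne_zero (A : O14) (z : S3) : (A.1.1 *ᵥ lightVec z) (Sum.inl 0) ≠ 0 := by
  intro h0
  have h := sum_sq_mulVec A z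
  rw [h0, zero_pow two_ne_zero, Finset.sum_eq_zero_iff_of_nonneg (fun i _ => sq_nonneg _)] at h
  have hz : A.1.1 *ᵥ lightVec z = 0 := by
    funext i
    rcases i with i | i
    · rw [Subsingleton.elim i 0, h0]; rfl
    · simpa using h i (Finset.mem_univ i)
  have h1 : (A.1⁻¹).1 *ᵥ (A.1.1 *ᵥ lightVec z) = lightVec z := by
    rw [Matrix.mulVec_mulVec]; simp
  rw [hz, Matrix.mulVec_zero] at h1
  have := congrFun h1 (Sum.inl 0)
  simp [lightVec] at this

/-- The conformal action of `O(1,4)` on `S³`: the coordinates of `A (1, z)ᵀ` after the initial one,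
divided by the initial one. By `conformalAct_eq_iff`, this is the unique `z'` in `S³` such that
`A (1, z)ᵀ` is a real multiple of `(1, z')ᵀ`. -/
def conformalAct (A : O14) (z : S3) : S3 :=
  ⟨WithLp.toLp 2 fun i => (A.1.1 *ᵥ lightVec z) (Sum.inr i) / (A.1.1 *ᵥ lightVec z) (Sum.inl 0), by
    rw [mem_sphere_zero_iff_norm, ← sq_eq_sq₀ (norm_nonneg _) zero_le_one,
      EuclideanSpace.real_norm_sq_eq]
    simp only [div_pow]
    rw [← Finset.sum_div, sum_sq_mulVec, one_pow,
      div_self (pow_ne_zero 2 (mulVec_lightVec_ne_zero A z))]⟩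

theorem conformalAct_eq_iff (A : O14) (z z' : S3) :
    conformalAct A z = z' ↔ ∃ c : ℝ, A.1.1 *ᵥ lightVec z = c • lightVec z' := by
  have hne := mulVec_lightVec_ne_zero A z
  constructor
  · rintro rfl
    refine ⟨(A.1.1 *ᵥ lightVec z) (Sum.inl 0), ?_⟩
    funext i
    rcases i with i | i
    · rw [Subsingleton.elim i 0]; simp [lightVec]
    · have h1 : ∀ w : S3, lightVec w (Sum.inr i) = (w : EuclideanSpace ℝ (Fin 4)) i := fun _ => rfl
      rw [Pi.smul_apply, smul_eq_mul, h1]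
      simp only [conformalAct]
      field_simp
  · rintro ⟨c, hc⟩
    have h0 : (A.1.1 *ᵥ lightVec z) (Sum.inl 0) = c := by rw [hc]; simp [lightVec]
    rw [h0] at hne
    apply Subtype.ext
    ext i
    have hi : (A.1.1 *ᵥ lightVec z) (Sum.inr i) = c * (z' : EuclideanSpace ℝ (Fin 4)) i := by
      rw [hc]; simp [lightVec]
    simp only [conformalAct]
    rw [h0, hi]
    field_simp

end SpinConf

end

/-! Identify `(x₀, z) ∈ ℝ^{1+4}` with the Hermitian matrix `P = (x₀, z̄; z, x₀)` and let `Sp(1,1)`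
act by `P ↦ g P gᴴ`. The equality of the two diagonal entries says that `Re tr(δ P) = 0`, and `gᴴ δ
g = δ` preserves this. The Clifford relation `(P δ)² = (x₀² - |z|²) · 1` then makes the action
isometric: since `δ gᴴ δ = g⁻¹`, it conjugates `P δ` by `g`. This is a continuous morphism `spinHom`
into `O(1,4)`.

Its derivative at the identity is `P ↦ X P + P Xᴴ`, which in coordinates is `fMatrix X`
(`herm_fMatrix_mulVec`). So `fMatrix` respects brackets, and an explicit inverse makes it an
isomorphism. The light vector `(1, ū)` corresponds to the rank one matrix `(u; 1)(u; 1)ᴴ`, which `g`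
carries to `(Au + B; Cu + D)(Au + B; Cu + D)ᴴ`, a positive multiple of the matrix of `g ∗ u`. This
is the equivariance (`conformalAct_spinHom`).

Everything else rests on the fact that differentiable one-parameter groups generate `Sp(1,1)`
(`eq_top_of_isOneParam_mem`). Their images are curves through `1`, so `spinHom` lands in the
identity component. A morphism integrating `f` is determined on them by `f`, because a one-parameter
matrix group is determined by its velocity (`oneParam_unique`). Hence `F` is unique, and
equivariance need only be checked for `spinCover`. -/

noncomputable section

namespace SpinConf

/-! ### The Hermitian model of `ℝ^{1+4}`. -/

/-- The quaternion with the given coordinates. -/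
def ofCoords (x : Fin 4 → ℝ) : ℍ[ℝ] := ⟨x 0, x 1, x 2, x 3⟩

@[simp] theorem re_ofCoords (x : Fin 4 → ℝ) : (ofCoords x).re = x 0 := rfl

@[simp] theorem imI_ofCoords (x : Fin 4 → ℝ) : (ofCoords x).imI = x 1 := rfl

@[simp] theorem imJ_ofCoords (x : Fin 4 → ℝ) : (ofCoords x).imJ = x 2 := rfl

@[simp] theorem imK_ofCoords (x : Fin 4 → ℝ) : (ofCoords x).imK = x 3 := rfl

/-- The Hermitian matrix `(x₀, z̄; z, x₀)` attached to the vector `(x₀, z)` of `ℝ^{1+4}`. -/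
def herm : (Fin 1 ⊕ Fin 4 → ℝ) →ₗ[ℝ] Matrix (Fin 2) (Fin 2) ℍ[ℝ] where
  toFun v := !![((v (Sum.inl 0) : ℝ) : ℍ[ℝ]), star (ofCoords fun i => v (Sum.inr i));
    ofCoords fun i => v (Sum.inr i), ((v (Sum.inl 0) : ℝ) : ℍ[ℝ])]
  map_add' v w := by
    ext i j <;> fin_cases i <;> fin_cases j <;> simp [add_comm]
  map_smul' c v := by
    ext i j <;> fin_cases i <;> fin_cases j <;> simp

/-- The left inverse of `herm`, read off from the initial column. -/
def unherm : Matrix (Fin 2) (Fin 2) ℍ[ℝ] →ₗ[ℝ] (Fin 1 ⊕ Fin 4 → ℝ) where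
  toFun P := Sum.elim (fun _ => (P 0 0).re) (coords (P 1 0))
  map_add' P Q := by
    ext i; rcases i with i | i
    · simp
    · fin_cases i <;> simp [coords]
  map_smul' c P := by
    ext i; rcases i with i | i
    · simp
    · fin_cases i <;> simp [coords]

theorem unherm_herm (v : Fin 1 ⊕ Fin 4 → ℝ) : unherm (herm v) = v := by
  ext i; rcases i with i | i
  · fin_cases i; simp [unherm, herm]
  · fin_cases i <;> simp [unherm, herm, coords]

theorem herm_injective : Function.Injective herm :=
  Function.LeftInverse.injective unherm_herm

theorem herm_unherm {P : Matrix (Fin 2) (Fin 2) ℍ[ℝ]} (hP : Pᴴ = P)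
    (hre : (P 0 0).re = (P 1 1).re) : herm (unherm P) = P := by
  have e := fun i j => congrFun (congrFun hP i) j
  simp only [Matrix.conjTranspose_apply] at e
  have e00 := e 0 0
  have e01 := e 0 1
  have e11 := e 1 1
  simp only [Quaternion.ext_iff, Quaternion.re_star, Quaternion.imI_star, Quaternion.imJ_star,
    Quaternion.imK_star] at e00 e01 e11
  ext i j <;> fin_cases i <;> fin_cases j <;>
    simp [herm, unherm, coords] <;> grind

theorem herm_conjTranspose (v : Fin 1 ⊕ Fin 4 → ℝ) : (herm v)ᴴ = herm v := by
  ext i j <;> fin_cases i <;> fin_cases j <;> simp [herm]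

theorem herm_mul_delta (v : Fin 1 ⊕ Fin 4 → ℝ) :
    herm v * delta = !![((v (Sum.inl 0) : ℝ) : ℍ[ℝ]), -star (ofCoords fun i => v (Sum.inr i));
      ofCoords fun i => v (Sum.inr i), -((v (Sum.inl 0) : ℝ) : ℍ[ℝ])] := by
  refine Matrix.ext fun i j => ?_
  rw [delta, Matrix.mul_diagonal]
  fin_cases i <;> fin_cases j <;> simp [herm]

/-- The bilinear form of signature `(1, 4)` in terms of Hermitian matrices. -/
theorem herm_delta_polar (v w : Fin 1 ⊕ Fin 4 → ℝ) :
    herm v * delta * (herm w * delta) + herm w * delta * (herm v * delta) =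
      (2 * (v ⬝ᵥ (LieAlgebra.Orthogonal.indefiniteDiagonal (Fin 1) (Fin 4) ℝ *ᵥ w))) • 1 := by
  have h : v ⬝ᵥ (LieAlgebra.Orthogonal.indefiniteDiagonal (Fin 1) (Fin 4) ℝ *ᵥ w) =
      v (Sum.inl 0) * w (Sum.inl 0) - ∑ i, v (Sum.inr i) * w (Sum.inr i) := by
    simp only [LieAlgebra.Orthogonal.indefiniteDiagonal, dotProduct, Matrix.mulVec_diagonal,
      Fintype.sum_sum_type, Sum.elim_inl, Sum.elim_inr, Fin.sum_univ_succ, Fin.sum_univ_zero]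
    simp
    ring
  rw [h, Fin.sum_univ_four, herm_mul_delta, herm_mul_delta]
  ext i j <;> fin_cases i <;> fin_cases j <;> simp <;> ring

/-! ### The action on Hermitian matrices and the morphism to `O(1,4)`. -/

/-- The map `P ↦ g P gᴴ`. -/
def conjBy (g : Matrix (Fin 2) (Fin 2) ℍ[ℝ]) :
    Matrix (Fin 2) (Fin 2) ℍ[ℝ] →ₗ[ℝ] Matrix (Fin 2) (Fin 2) ℍ[ℝ] where
  toFun P := g * P * gᴴ
  map_add' P Q := by rw [mul_add, add_mul]
  map_smul' c P := by simp

/-- The matrix of `P ↦ g P gᴴ` on the space of the Hermitian matrices `herm v`. -/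
def spinMatrix (g : Matrix (Fin 2) (Fin 2) ℍ[ℝ]) :
    Matrix (Fin 1 ⊕ Fin 4) (Fin 1 ⊕ Fin 4) ℝ :=
  LinearMap.toMatrix' (unherm ∘ₗ conjBy g ∘ₗ herm)

theorem spinMatrix_mulVec (g : Matrix (Fin 2) (Fin 2) ℍ[ℝ]) (v : Fin 1 ⊕ Fin 4 → ℝ) :
    spinMatrix g *ᵥ v = unherm (g * herm v * gᴴ) := by
  rw [spinMatrix, LinearMap.toMatrix'_mulVec]; rfl

theorem spinMatrix_apply (g : Matrix (Fin 2) (Fin 2) ℍ[ℝ]) (i j : Fin 1 ⊕ Fin 4) :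
    spinMatrix g i j = unherm (g * herm (Pi.single j 1) * gᴴ) i := by
  rw [← spinMatrix_mulVec, Matrix.mulVec_single_one]; rfl

theorem delta_mul_delta : delta * delta = 1 := by
  ext i j <;> fin_cases i <;> fin_cases j <;> simp [delta]

theorem conjTranspose_mul_delta (g : Sp11) : (g.1.1)ᴴ * delta * g.1.1 = delta := g.2

/-- The defining relation makes `δ gᴴ δ` a left inverse of `g`. As `g` is invertible, it is also a
right inverse. -/
theorem mul_delta_conjTranspose (g : Sp11) : g.1.1 * delta * (g.1.1)ᴴ = delta := by
  have h : (delta * (g.1.1)ᴴ * delta) * g.1.1 = 1 := by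
    rw [mul_assoc delta, mul_assoc delta, conjTranspose_mul_delta, delta_mul_delta]
  have h2 : delta * (g.1.1)ᴴ * delta = (g.1⁻¹).1 := by
    rw [← mul_one (delta * _ * delta), ← Units.mul_inv g.1, ← mul_assoc, h, one_mul]
  have h3 : g.1.1 * (delta * (g.1.1)ᴴ * delta) = 1 := by rw [h2, Units.mul_inv]
  calc _ = g.1.1 * (delta * (g.1.1)ᴴ * delta) * delta := by
        simp only [mul_assoc, delta_mul_delta, mul_one]
    _ = delta := by rw [h3, one_mul]

/-- The entries of the relation `gᴴ δ g = δ`. -/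
theorem entries_of_mem_Sp11 (g : Sp11) :
    star (g.1.1 0 0) * g.1.1 0 0 - star (g.1.1 1 0) * g.1.1 1 0 = 1 ∧
    star (g.1.1 0 0) * g.1.1 0 1 - star (g.1.1 1 0) * g.1.1 1 1 = 0 ∧
    star (g.1.1 0 1) * g.1.1 0 1 - star (g.1.1 1 1) * g.1.1 1 1 = -1 := by
  have e := fun i j => congrFun (congrFun (conjTranspose_mul_delta g) i) j
  simp only [Matrix.mul_apply, Fin.sum_univ_two, delta,
    Matrix.conjTranspose_apply, Matrix.diagonal_apply] at e
  have e00 := e 0 0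
  have e01 := e 0 1
  have e11 := e 1 1
  simp at e00 e01 e11
  simp only [sub_eq_add_neg]
  exact ⟨e00, e01, e11⟩

/-- `spinMatrix` reads only the first column of `g P gᴴ`, so the point is that nothing is lost. The
product is Hermitian, and its diagonal entries have equal real parts because `Re tr(δ g P gᴴ) = Re
tr(gᴴ δ g P) = Re tr(δ P) = 0`. -/
theorem herm_spinMatrix_mulVec (g : Sp11) (v : Fin 1 ⊕ Fin 4 → ℝ) :
    herm (spinMatrix g.1.1 *ᵥ v) = g.1.1 * herm v * (g.1.1)ᴴ := by
  rw [spinMatrix_mulVec, herm_unherm]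
  · simp only [Matrix.conjTranspose_mul, Matrix.conjTranspose_conjTranspose, herm_conjTranspose,
      mul_assoc]
  · obtain ⟨h0, h1, h2⟩ := entries_of_mem_Sp11 g
    simp only [herm, LinearMap.coe_mk, AddHom.coe_mk, Matrix.mul_apply, Fin.sum_univ_two,
      Matrix.conjTranspose_apply, Matrix.of_apply, Matrix.cons_val', Matrix.cons_val_zero,
      Matrix.cons_val_one, Matrix.cons_val_fin_one]
    generalize g.1.1 0 0 = a at *
    generalize g.1.1 0 1 = b at *
    generalize g.1.1 1 0 = c at *
    generalize g.1.1 1 1 = d at *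
    generalize v (Sum.inl 0) = x
    generalize (ofCoords fun i => v (Sum.inr i)) = z
    simp only [Quaternion.ext_iff, Quaternion.re_sub, Quaternion.imI_sub, Quaternion.imJ_sub,
      Quaternion.imK_sub, Quaternion.re_mul, Quaternion.imI_mul, Quaternion.imJ_mul,
      Quaternion.imK_mul, Quaternion.re_star, Quaternion.imI_star, Quaternion.imJ_star,
      Quaternion.imK_star, Quaternion.re_zero, Quaternion.imI_zero, Quaternion.imJ_zero,
      Quaternion.imK_zero, Quaternion.re_one, Quaternion.re_neg] at h0 h1 h2
    simp only [Quaternion.re_add, Quaternion.imI_add, Quaternion.imJ_add, Quaternion.imK_add,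
      Quaternion.re_mul, Quaternion.imI_mul, Quaternion.imJ_mul,
      Quaternion.imK_mul, Quaternion.re_star, Quaternion.imI_star, Quaternion.imJ_star,
      Quaternion.imK_star, Quaternion.re_coe, Quaternion.imI_coe, Quaternion.imJ_coe,
      Quaternion.imK_coe]
    obtain ⟨k0, -⟩ := h0
    obtain ⟨k1, k2, k3, k4⟩ := h1
    obtain ⟨k5, -⟩ := h2
    -- The coordinate form of this trace identity: `x` multiplies the diagonal entries of `gᴴ δ g =
    -- δ`, and the off-diagonal entry is paired with `z` through `2 Re(z (āb - c̄d)) = 0`.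
    linear_combination x * k0 + x * k5 + 2 * z.re * k1 - 2 * z.imI * k2 - 2 * z.imJ * k3
      - 2 * z.imK * k4

theorem spinMatrix_mul (g h : Sp11) :
    spinMatrix (g * h).1.1 = spinMatrix g.1.1 * spinMatrix h.1.1 := by
  refine Matrix.ext_of_mulVec_single fun j => herm_injective ?_
  rw [← Matrix.mulVec_mulVec, herm_spinMatrix_mulVec, herm_spinMatrix_mulVec,
    herm_spinMatrix_mulVec]
  simp only [Subgroup.coe_mul, Units.val_mul, Matrix.conjTranspose_mul, mul_assoc]

theorem spinMatrix_one : spinMatrix 1 = 1 := by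
  refine Matrix.ext_of_mulVec_single fun j => ?_
  rw [spinMatrix_mulVec, Matrix.conjTranspose_one, one_mul, mul_one, unherm_herm, Matrix.one_mulVec]

/-- By `herm_delta_polar` the bilinear form is the scalar in an anticommutator of the matrices `herm
v * delta`. The action conjugates these by `g`, which fixes scalars. -/
theorem spinMatrix_mem (g : Sp11) :
    (spinMatrix g.1.1)ᵀ * LieAlgebra.Orthogonal.indefiniteDiagonal (Fin 1) (Fin 4) ℝ *
      spinMatrix g.1.1 = LieAlgebra.Orthogonal.indefiniteDiagonal (Fin 1) (Fin 4) ℝ := by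
  set J := LieAlgebra.Orthogonal.indefiniteDiagonal (Fin 1) (Fin 4) ℝ with hJ
  set A := spinMatrix g.1.1 with hA
  have key : ∀ v w, herm (A *ᵥ v) * delta * (herm (A *ᵥ w) * delta) =
      g.1.1 * (herm v * delta * (herm w * delta)) * (delta * (g.1.1)ᴴ * delta) := by
    intro v w
    have hd : (g.1.1)ᴴ * (delta * g.1.1) = delta := by
      rw [← mul_assoc, conjTranspose_mul_delta]
    rw [hA, herm_spinMatrix_mulVec, herm_spinMatrix_mulVec]
    calc _ = g.1.1 * herm v * ((g.1.1)ᴴ * (delta * g.1.1)) * herm w * (g.1.1)ᴴ * delta := by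
          simp only [mul_assoc]
      _ = g.1.1 * herm v * delta * herm w * (delta * delta) * (g.1.1)ᴴ * delta := by
          rw [hd, delta_mul_delta, mul_one]
      _ = _ := by simp only [mul_assoc]
  have hone : g.1.1 * (delta * (g.1.1)ᴴ * delta) = 1 := by
    rw [← mul_assoc, ← mul_assoc, mul_delta_conjTranspose, delta_mul_delta]
  have hB : ∀ v w, (A *ᵥ v) ⬝ᵥ (J *ᵥ (A *ᵥ w)) = v ⬝ᵥ (J *ᵥ w) := by
    intro v w
    have h1 := herm_delta_polar (A *ᵥ v) (A *ᵥ w)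
    rw [key, key, ← add_mul, ← mul_add, herm_delta_polar, mul_smul_comm, smul_mul_assoc, mul_one,
      hone] at h1
    have h2 := congrArg (fun P : Matrix (Fin 2) (Fin 2) ℍ[ℝ] => (P 0 0).re) h1
    simp [-Matrix.mulVec_mulVec] at h2
    exact h2.symm
  ext i j
  have := hB (Pi.single i 1) (Pi.single j 1)
  rw [Matrix.dotProduct_mulVec, Matrix.vecMul_mulVec, ← Matrix.dotProduct_mulVec,
    Matrix.mulVec_mulVec] at this
  simpa using this

/-- The morphism `Sp(1,1) → O(1,4)` given by the action on Hermitian matrices. -/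
def spinHom : Sp11 →* O14 :=
  (MonoidHom.toHomUnits
    { toFun := fun g : Sp11 => spinMatrix g.1.1
      map_one' := spinMatrix_one
      map_mul' := spinMatrix_mul }).codRestrict O14 spinMatrix_mem

theorem coe_spinHom (g : Sp11) : (spinHom g).1.1 = spinMatrix g.1.1 := rfl

/-! ### Continuity of the morphism and its compatibility with the Möbius action. -/

theorem continuous_coords {X : Type*} [TopologicalSpace X] {q : X → ℍ[ℝ]} (hq : Continuous q)
    (i : Fin 4) : Continuous fun x => coords (q x) i := by
  fin_cases i
  · exact Quaternion.continuous_re.comp hq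
  · exact Quaternion.continuous_imI.comp hq
  · exact Quaternion.continuous_imJ.comp hq
  · exact Quaternion.continuous_imK.comp hq

theorem continuous_spinMatrix : Continuous spinMatrix := by
  refine continuous_matrix fun i j => ?_
  simp only [spinMatrix_apply]
  have h : Continuous fun g : Matrix (Fin 2) (Fin 2) ℍ[ℝ] =>
      g * herm (Pi.single j 1) * gᴴ := by fun_prop
  rcases i with i | i
  · exact Quaternion.continuous_re.comp (h.matrix_elem 0 0)
  · exact continuous_coords (h.matrix_elem 1 0) i

theorem continuous_spinHom : Continuous spinHom := by
  have h : Continuous fun g : Sp11 => (g.1.1 : Matrix (Fin 2) (Fin 2) ℍ[ℝ]) :=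
    Units.continuous_val.comp continuous_subtype_val
  have h1 : Continuous fun g : Sp11 => spinMatrix g.1.1 := continuous_spinMatrix.comp h
  -- The topology on units also requires the inverse to vary continuously.
  have h2 : Continuous fun g : Sp11 => spinMatrix (g⁻¹).1.1 := h1.comp continuous_inv
  have h3 : Continuous fun g : Sp11 => (spinHom g).1 := Units.continuous_iff.2 ⟨h1, h2⟩
  exact continuous_induced_rng.2 h3

/-- The matrix of `(1, ū)` factors as `(u; 1)(u; 1)ᴴ`, and `g (u; 1) = (g ∗ u; 1)(Cu + D)`. The
conjugate in `rho` is what puts `u` in the upper right corner. -/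
theorem conformalAct_spinHom (g : Sp11) (u : Sp1) :
    conformalAct (spinHom g) (rho u) = rho (mobiusAct g u) := by
  have hl : ∀ w : Sp1, herm (lightVec (rho w)) = !![1, (w : ℍ[ℝ]); star (w : ℍ[ℝ]), 1] := by
    intro w
    have h : (ofCoords fun i => lightVec (rho w) (Sum.inr i)) = star (w : ℍ[ℝ]) := rfl
    refine Matrix.ext fun i j => ?_
    fin_cases i <;> fin_cases j <;> simp [herm, h] <;> simp [lightVec]
  rw [conformalAct_eq_iff]
  -- The conformal factor is `|Cu + D|²`, the lower right entry of the transformed matrix.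
  refine ⟨Quaternion.normSq (mobDen g u), herm_injective ?_⟩
  rw [coe_spinHom, herm_spinMatrix_mulVec, map_smul, hl, hl]
  have hu : (u : ℍ[ℝ]) * star (u : ℍ[ℝ]) = 1 := Unitary.coe_mul_star_self u
  have hN : mobNum g u * star (mobNum g u) = mobDen g u * star (mobDen g u) := by
    rw [Quaternion.self_mul_star, Quaternion.self_mul_star, Quaternion.normSq_eq_norm_mul_self,
      norm_mobNum, ← Quaternion.normSq_eq_norm_mul_self]
  have hL : g.1.1 * !![1, (u : ℍ[ℝ]); star (u : ℍ[ℝ]), 1] * (g.1.1)ᴴ =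
      !![mobNum g u * star (mobNum g u), mobNum g u * star (mobDen g u);
        mobDen g u * star (mobNum g u), mobDen g u * star (mobDen g u)] := by
    have hu' : ∀ q : ℍ[ℝ], (u : ℍ[ℝ]) * (star (u : ℍ[ℝ]) * q) = q := fun q => by
      rw [← mul_assoc, hu, one_mul]
    refine Matrix.ext fun i j => ?_
    fin_cases i <;> fin_cases j <;>
      simp [Matrix.mul_apply, mobNum, mobDen, Fin.sum_univ_two, mul_add, add_mul, mul_assoc,
        hu']
  have hD := mobDen_ne_zero g u
  have hc : ∀ q : ℍ[ℝ], Quaternion.normSq (mobDen g u) • q =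
      mobDen g u * star (mobDen g u) * q := by
    intro q; rw [Quaternion.self_mul_star, Quaternion.coe_mul_eq_smul]
  have hc2 : Quaternion.normSq (mobDen g u) • (mobNum g u * (mobDen g u)⁻¹) =
      mobNum g u * star (mobDen g u) := by
    rw [Quaternion.inv_def, mul_smul_comm, smul_smul,
      mul_inv_cancel₀ (Quaternion.normSq_ne_zero.2 hD), one_smul]
  have hc3 : Quaternion.normSq (mobDen g u) • star (mobNum g u * (mobDen g u)⁻¹) =
      mobDen g u * star (mobNum g u) := by
    rw [← Quaternion.star_smul, hc2, star_mul, star_star]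
  rw [hL, hN]
  refine Matrix.ext fun i j => ?_
  fin_cases i <;> fin_cases j
  · simp [hc]
  · exact hc2.symm
  · exact hc3.symm
  · simp [hc]

/-! ### The differential of the action at the identity. -/

/-- The derivative of a product of curves of matrices, entrywise. -/
theorem hasDerivAt_matrix_mul {𝔸 : Type*} [NormedRing 𝔸] [NormedAlgebra ℝ 𝔸] {n : Type*} [Fintype n]
    {A B : ℝ → Matrix n n 𝔸} {A' B' : Matrix n n 𝔸} {t : ℝ}
    (hA : ∀ i j, HasDerivAt (fun s => A s i j) (A' i j) t)
    (hB : ∀ i j, HasDerivAt (fun s => B s i j) (B' i j) t) (i j : n) :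
    HasDerivAt (fun s => (A s * B s) i j) ((A' * B t + A t * B') i j) t := by
  simp only [Matrix.add_apply, Matrix.mul_apply, ← Finset.sum_add_distrib]
  exact HasDerivAt.fun_sum fun k _ => (hA i k).mul (hB k j)

theorem hasDerivAt_quaternion_star {q : ℝ → ℍ[ℝ]} {q' : ℍ[ℝ]} {t : ℝ} (hq : HasDerivAt q q' t) :
    HasDerivAt (fun s => star (q s)) (star q') t := by
  let L : ℍ[ℝ] →ₗ[ℝ] ℍ[ℝ] :=
    { toFun := star, map_add' := star_add, map_smul' := fun c x => Quaternion.star_smul c x }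
  exact (LinearMap.toContinuousLinearMap L).hasFDerivAt.comp_hasDerivAt t hq

theorem hasDerivAt_coords {q : ℝ → ℍ[ℝ]} {q' : ℍ[ℝ]} {t : ℝ} (hq : HasDerivAt q q' t)
    (i : Fin 4) : HasDerivAt (fun s => coords (q s) i) (coords q' i) t := by
  have h := ((EuclideanSpace.proj i : EuclideanSpace ℝ (Fin 4) →L[ℝ] ℝ) ∘L
    (Quaternion.linearIsometryEquivTuple.toContinuousLinearEquiv :
      ℍ[ℝ] →L[ℝ] EuclideanSpace ℝ (Fin 4))).hasFDerivAt.comp_hasDerivAt t hq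
  exact h

theorem hasDerivAt_unherm {P : ℝ → Matrix (Fin 2) (Fin 2) ℍ[ℝ]} {P' : Matrix (Fin 2) (Fin 2) ℍ[ℝ]}
    {t : ℝ} (hP : ∀ i j, HasDerivAt (fun s => P s i j) (P' i j) t) (k : Fin 1 ⊕ Fin 4) :
    HasDerivAt (fun s => unherm (P s) k) (unherm P' k) t := by
  rcases k with k | k
  · exact hasDerivAt_coords (hP 0 0) 0
  · exact hasDerivAt_coords (hP 1 0) k

theorem leftSubRight_eq (η ξ : ℍ[ℝ]) : leftSubRight η ξ =
    !![η.re - ξ.re, ξ.imI - η.imI, ξ.imJ - η.imJ, ξ.imK - η.imK;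
      η.imI - ξ.imI, η.re - ξ.re, -η.imK - ξ.imK, η.imJ + ξ.imJ;
      η.imJ - ξ.imJ, η.imK + ξ.imK, η.re - ξ.re, -η.imI - ξ.imI;
      η.imK - ξ.imK, -η.imJ - ξ.imJ, η.imI + ξ.imI, η.re - ξ.re] := by
  refine Matrix.ext fun i j => ?_
  fin_cases i <;> fin_cases j <;> simp [leftSubRight, unitQ, coords] <;> ring

theorem fMatrix_mulVec_inl (X : Matrix (Fin 2) (Fin 2) ℍ[ℝ]) (v : Fin 1 ⊕ Fin 4 → ℝ) :
    (fMatrix X *ᵥ v) (Sum.inl 0) = 2 * ((X 1 0).re * v (Sum.inr 0) +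
      (X 1 0).imI * v (Sum.inr 1) + (X 1 0).imJ * v (Sum.inr 2) + (X 1 0).imK * v (Sum.inr 3)) := by
  simp [Matrix.mulVec, dotProduct, fMatrix, col, coords, Fin.sum_univ_four]
  ring

theorem fMatrix_mulVec_inr (X : Matrix (Fin 2) (Fin 2) ℍ[ℝ]) (v : Fin 1 ⊕ Fin 4 → ℝ) :
    (ofCoords fun i => (fMatrix X *ᵥ v) (Sum.inr i)) =
      (2 * v (Sum.inl 0)) • X 1 0 + X 1 1 * (ofCoords fun i => v (Sum.inr i)) -
        (ofCoords fun i => v (Sum.inr i)) * X 0 0 := by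
  ext <;> simp [Matrix.mulVec, dotProduct, fMatrix, col, coords, Fin.sum_univ_four,
    leftSubRight_eq] <;> ring

/-- On the diagonal, the terms in `ξ` and `η` cancel because these are imaginary and `x` is real.
Both entries that remain equal `2 Re(ᾱz)`. -/
theorem infinitesimal_conj (ξ η α z : ℍ[ℝ]) (x : ℝ) (hξ : star ξ = -ξ) (hη : star η = -η) :
    !![ξ, star α; α, η] * !![(x : ℍ[ℝ]), star z; z, (x : ℍ[ℝ])] +
      !![(x : ℍ[ℝ]), star z; z, (x : ℍ[ℝ])] * !![star ξ, star α; α, star η] =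
    !![star α * z + star z * α, star ((2 * x) • α + η * z - z * ξ);
      (2 * x) • α + η * z - z * ξ, star α * z + star z * α] := by
  have hx : ∀ q : ℍ[ℝ], q * (x : ℍ[ℝ]) = (x : ℍ[ℝ]) * q := fun q =>
    (Quaternion.coe_commutes x q).symm
  have h2 : ∀ q : ℍ[ℝ], (2 * x) • q = (x : ℍ[ℝ]) * q + (x : ℍ[ℝ]) * q := fun q => by
    rw [Quaternion.coe_mul_eq_smul, two_mul, add_smul]
  have hz : star α * z + star z * α = α * star z + z * star α := by
    ext <;> simp <;> ring
  rw [Matrix.mul_fin_two, Matrix.mul_fin_two, hξ, hη]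
  refine Matrix.ext fun i j => ?_
  fin_cases i <;> fin_cases j
  · simp [hx]; abel
  · simp [hx, h2, hξ, hη]; abel
  · simp [hx, h2]; abel
  · simp [hx, hz]; abel

/-- The infinitesimal action of `sp(1,1)` on Hermitian matrices is `fMatrix`. -/
theorem herm_fMatrix_mulVec {X : Matrix (Fin 2) (Fin 2) ℍ[ℝ]} (hX : X ∈ sp11)
    (v : Fin 1 ⊕ Fin 4 → ℝ) :
    herm (fMatrix X *ᵥ v) = X * herm v + herm v * Xᴴ := by
  obtain ⟨h0, h1, h2⟩ := (mem_sp11_iff X).1 hX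
  have hX1 : X * herm v = !![X 0 0, star (X 1 0); X 1 0, X 1 1] * herm v := by
    rw [← h2, ← Matrix.eta_fin_two X]
  have hX2 : Xᴴ = !![star (X 0 0), star (X 1 0); X 1 0, star (X 1 1)] := by
    rw [Matrix.eta_fin_two Xᴴ]; simp [Matrix.conjTranspose_apply, h2]
  have h : ∀ w, herm w = !![((w (Sum.inl 0) : ℝ) : ℍ[ℝ]), star (ofCoords fun i => w (Sum.inr i));
    ofCoords fun i => w (Sum.inr i), ((w (Sum.inl 0) : ℝ) : ℍ[ℝ])] := fun _ => rfl
  have hs : ∀ α z : ℍ[ℝ], star α * z + star z * α =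
      ((2 * (α.re * z.re + α.imI * z.imI + α.imJ * z.imJ + α.imK * z.imK) : ℝ) : ℍ[ℝ]) := by
    intro α z
    ext <;> simp <;> ring
  rw [hX1, hX2, h v, infinitesimal_conj _ _ _ _ _ (Quaternion.star_eq_neg.2 h0)
    (Quaternion.star_eq_neg.2 h1), h, fMatrix_mulVec_inl, fMatrix_mulVec_inr, hs]
  rfl

theorem fMatrix_apply_eq_unherm {X : Matrix (Fin 2) (Fin 2) ℍ[ℝ]} (hX : X ∈ sp11)
    (i j : Fin 1 ⊕ Fin 4) :
    fMatrix X i j =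
      unherm (X * herm (Pi.single j 1) + herm (Pi.single j 1) * Xᴴ) i := by
  rw [← herm_fMatrix_mulVec hX, unherm_herm, Matrix.mulVec_single_one]; rfl

/-! ### The isomorphism of Lie algebras. -/

theorem fMatrix_mem {X : Matrix (Fin 2) (Fin 2) ℍ[ℝ]} (hX : X ∈ sp11) : fMatrix X ∈ o14 := by
  obtain ⟨h0, h1, h2⟩ := (mem_sp11_iff X).1 hX
  rw [o14, LieAlgebra.Orthogonal.so', mem_skewAdjointMatricesLieSubalgebra,
    mem_skewAdjointMatricesSubmodule]
  change (fMatrix X)ᵀ * _ = _ * (-fMatrix X)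
  ext i j
  rw [LieAlgebra.Orthogonal.indefiniteDiagonal, Matrix.mul_diagonal, Matrix.diagonal_mul]
  rcases i with i | i <;> rcases j with j | j <;> fin_cases i <;> fin_cases j <;>
    simp [fMatrix, col, coords, leftSubRight_eq, h0, h1] <;> ring

/-- The inverse of `fMatrix`. -/
def fInv (Y : Matrix (Fin 1 ⊕ Fin 4) (Fin 1 ⊕ Fin 4) ℝ) : Matrix (Fin 2) (Fin 2) ℍ[ℝ] :=
  let y : Fin 4 → Fin 4 → ℝ := fun i j => Y (Sum.inr i) (Sum.inr j)
  let α : ℍ[ℝ] := ofCoords fun i => Y (Sum.inr i) (Sum.inl 0) / 2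
  -- The first column of `L_η - R_ξ` gives `η - ξ`, and the entries `(3,2)`, `(1,3)`, `(2,1)` give
  -- the coordinates of `η + ξ`. Half sums and half differences recover `η` and `ξ`.
  !![ofCoords ![0, (y 3 2 - y 1 0) / 2, (y 1 3 - y 2 0) / 2, (y 2 1 - y 3 0) / 2], star α;
    α, ofCoords ![0, (y 3 2 + y 1 0) / 2, (y 1 3 + y 2 0) / 2, (y 2 1 + y 3 0) / 2]]

theorem fInv_mem (Y : Matrix (Fin 1 ⊕ Fin 4) (Fin 1 ⊕ Fin 4) ℝ) : fInv Y ∈ sp11 := by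
  rw [mem_sp11_iff]
  exact ⟨rfl, rfl, rfl⟩

theorem fInv_fMatrix {X : Matrix (Fin 2) (Fin 2) ℍ[ℝ]} (hX : X ∈ sp11) : fInv (fMatrix X) = X := by
  obtain ⟨h0, h1, h2⟩ := (mem_sp11_iff X).1 hX
  ext i j <;> fin_cases i <;> fin_cases j <;>
    simp [fInv, fMatrix, col, coords, leftSubRight_eq, h0, h1, h2]

theorem fMatrix_fInv {Y : Matrix (Fin 1 ⊕ Fin 4) (Fin 1 ⊕ Fin 4) ℝ} (hY : Y ∈ o14) :
    fMatrix (fInv Y) = Y := by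
  rw [o14, LieAlgebra.Orthogonal.so', mem_skewAdjointMatricesLieSubalgebra,
    mem_skewAdjointMatricesSubmodule] at hY
  change Yᵀ * _ = _ * (-Y) at hY
  have e := fun i j => congrFun (congrFun hY i) j
  simp only [LieAlgebra.Orthogonal.indefiniteDiagonal, Matrix.mul_diagonal, Matrix.diagonal_mul,
    Matrix.transpose_apply, Matrix.neg_apply] at e
  have e1 : Y (Sum.inl 0) (Sum.inl 0) = 0 := by
    have := e (Sum.inl 0) (Sum.inl 0); simp at this; linarith
  have e2 : ∀ i, Y (Sum.inl 0) (Sum.inr i) = Y (Sum.inr i) (Sum.inl 0) := by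
    intro i; have := e (Sum.inl 0) (Sum.inr i); simp at this; linarith
  have e3 : ∀ i j, Y (Sum.inr i) (Sum.inr j) = - Y (Sum.inr j) (Sum.inr i) := by
    intro i j; have := e (Sum.inr i) (Sum.inr j); simp at this; linarith
  have e4 : ∀ i, Y (Sum.inr i) (Sum.inr i) = 0 := by
    intro i; linarith [e3 i i]
  ext i j
  rcases i with i | i <;> rcases j with j | j <;> fin_cases i <;> fin_cases j <;>
    simp [fInv, fMatrix, col, coords, leftSubRight_eq, e1, e2, e4] <;>
    linarith [e3 0 1, e3 0 2, e3 0 3, e3 1 2, e3 1 3, e3 2 3]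

/-- Through `herm`, `fMatrix X` becomes `P ↦ X P + P Xᴴ`. Left multiplications commute with right
ones, so the commutator of two such maps is the map of `⁅X, Y⁆`. -/
theorem fMatrix_lie {X Y : Matrix (Fin 2) (Fin 2) ℍ[ℝ]} (hX : X ∈ sp11) (hY : Y ∈ sp11) :
    fMatrix ⁅X, Y⁆ = ⁅fMatrix X, fMatrix Y⁆ := by
  refine Matrix.ext_of_mulVec_single fun j => herm_injective ?_
  rw [herm_fMatrix_mulVec (sp11.lie_mem hX hY), Ring.lie_def, Ring.lie_def, Matrix.sub_mulVec,
    map_sub, ← Matrix.mulVec_mulVec, ← Matrix.mulVec_mulVec, herm_fMatrix_mulVec hX,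
    herm_fMatrix_mulVec hY, herm_fMatrix_mulVec hY, herm_fMatrix_mulVec hX,
    Matrix.conjTranspose_sub, Matrix.conjTranspose_mul, Matrix.conjTranspose_mul]
  noncomm_ring

/-- The isomorphism `sp(1,1) ≅ o(1,4)`. -/
def fEquiv : sp11 ≃ₗ⁅ℝ⁆ o14 where
  toFun X := ⟨fMatrix X, fMatrix_mem X.2⟩
  map_add' X Y := by
    refine Subtype.ext (Matrix.ext_of_mulVec_single fun j => herm_injective ?_)
    change herm (fMatrix (X + Y : sp11) *ᵥ _) = herm ((fMatrix X + fMatrix Y) *ᵥ _)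
    rw [Matrix.add_mulVec, map_add, herm_fMatrix_mulVec X.2, herm_fMatrix_mulVec Y.2,
      herm_fMatrix_mulVec (X + Y).2]
    change (X.1 + Y.1) * _ + _ * (X.1 + Y.1)ᴴ = _
    simp only [Matrix.conjTranspose_add, add_mul, mul_add]
    abel
  map_smul' c X := by
    refine Subtype.ext ?_
    change fMatrix (c • X : sp11) = c • fMatrix X
    ext i j
    rcases i with i | i <;> rcases j with j | j <;> fin_cases i <;> fin_cases j <;>
      simp [fMatrix, col, coords, leftSubRight_eq] <;> ring
  map_lie' {X Y} := Subtype.ext (fMatrix_lie X.2 Y.2)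
  invFun Y := ⟨fInv Y, fInv_mem Y⟩
  left_inv X := Subtype.ext (fInv_fMatrix X.2)
  right_inv Y := Subtype.ext (fMatrix_fInv Y.2)

/-- Entrywise derivative of a curve through the identity under `spinMatrix`. -/
theorem hasDerivAt_spinMatrix {A : ℝ → Matrix (Fin 2) (Fin 2) ℍ[ℝ]}
    {X : Matrix (Fin 2) (Fin 2) ℍ[ℝ]} (hX : X ∈ sp11) (h0 : A 0 = 1)
    (hA : ∀ i j, HasDerivAt (fun t => A t i j) (X i j) 0) (i j : Fin 1 ⊕ Fin 4) :
    HasDerivAt (fun t => spinMatrix (A t) i j) (fMatrix X i j) 0 := by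
  simp only [spinMatrix_apply]
  rw [fMatrix_apply_eq_unherm hX]
  refine hasDerivAt_unherm (fun k l => ?_) i
  set S := herm (Pi.single j 1)
  have h1 := hasDerivAt_matrix_mul (B := fun _ => S) (B' := 0) hA
    (fun i j => by simpa using hasDerivAt_const (0 : ℝ) (S i j))
  -- The product rule at `A 0 = 1` leaves `X S + S Xᴴ`.
  have h2 := hasDerivAt_matrix_mul (A := fun t => A t * S) (B := fun t => (A t)ᴴ) (B' := Xᴴ) h1
    (fun i j => hasDerivAt_quaternion_star (hA j i)) k l
  simpa [h0] using h2

/-! ### One-parameter groups and their uniqueness. -/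

/-- A one-parameter group of matrices that is differentiable at `0` is differentiable. -/
theorem hasDerivAt_of_add {𝔸 : Type*} [NormedRing 𝔸] [NormedAlgebra ℝ 𝔸] {n : Type*} [Fintype n]
    {φ : ℝ → Matrix n n 𝔸} {Y : Matrix n n 𝔸} (hadd : ∀ s t, φ (s + t) = φ s * φ t)
    (h0 : ∀ i j, HasDerivAt (fun s => φ s i j) (Y i j) 0) (t : ℝ) (i j : n) :
    HasDerivAt (fun s => φ s i j) ((φ t * Y) i j) t := by
  have h1 : ∀ i j, HasDerivAt (fun s => φ (s - t) i j) (Y i j) t := fun i j => by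
    have := h0 i j
    rw [← sub_self t] at this
    simpa using this.comp_sub_const t t
  have h2 := hasDerivAt_matrix_mul (A := fun _ => φ t) (A' := 0) (t := t)
    (fun i j => by simpa using hasDerivAt_const t (φ t i j)) h1 i j
  have h3 : ∀ s, φ t * φ (s - t) = φ s := fun s => by rw [← hadd, add_sub_cancel]
  simpa [h3] using h2

/-- One-parameter groups of matrices with the same velocity agree. -/
theorem oneParam_unique {n : Type*} [Fintype n] [DecidableEq n] {φ ψ : ℝ → Matrix n n ℝ}
    {Y : Matrix n n ℝ} (hφ : ∀ s t, φ (s + t) = φ s * φ t) (hψ : ∀ s t, ψ (s + t) = ψ s * ψ t)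
    (hφ0 : φ 0 = 1) (hψ0 : ψ 0 = 1) (dφ : ∀ i j, HasDerivAt (fun s => φ s i j) (Y i j) 0)
    (dψ : ∀ i j, HasDerivAt (fun s => ψ s i j) (Y i j) 0) : φ = ψ := by
  -- Differentiate `ψ t * ψ s = ψ s * ψ t` in `s` at `0`.
  have hcomm : ∀ t, ψ t * Y = Y * ψ t := fun t => by
    ext i j
    have h1 := hasDerivAt_matrix_mul (A := fun _ => ψ t) (A' := 0) (t := 0)
      (fun i j => by simpa using hasDerivAt_const (0 : ℝ) (ψ t i j)) dψ i j
    have h2 := hasDerivAt_matrix_mul (B := fun _ => ψ t) (B' := 0) (t := 0) dψ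
      (fun i j => by simpa using hasDerivAt_const (0 : ℝ) (ψ t i j)) i j
    have h3 : ∀ s, ψ t * ψ s = ψ s * ψ t := fun s => by rw [← hψ, ← hψ, add_comm]
    simp only [h3] at h1
    simpa [zero_mul, mul_zero] using h1.unique h2
  have hψn : ∀ t i j, HasDerivAt (fun s => ψ (-s) i j) ((-(Y * ψ (-t))) i j) t := fun t i j => by
    have h1 := hasDerivAt_of_add hψ dψ (-t) i j
    rw [hcomm] at h1
    have h2 := h1.scomp t (hasDerivAt_neg t)
    rw [neg_one_smul] at h2
    exact h2
  -- With `Y` moved to the left of `ψ (-t)`, the two terms of the derivative of `φ t * ψ (-t)`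
  -- cancel.
  have hconst : ∀ t, φ t * ψ (-t) = 1 := fun t => by
    ext i j
    have hd : ∀ t, HasDerivAt (fun s => (φ s * ψ (-s)) i j) 0 t := fun t => by
      have h := hasDerivAt_matrix_mul (B := fun s => ψ (-s)) (hasDerivAt_of_add hφ dφ t) (hψn t) i j
      have h0 : φ t * Y * ψ (-t) + φ t * -(Y * ψ (-t)) = 0 := by
        rw [mul_neg, mul_assoc, add_neg_cancel]
      rw [h0] at h
      exact h
    have h := is_const_of_deriv_eq_zero (fun t => (hd t).differentiableAt) (fun t => (hd t).deriv)
      t 0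
    simpa [hφ0, hψ0] using h
  funext t
  calc φ t = φ t * (ψ (-t) * ψ t) := by rw [← hψ, neg_add_cancel, hψ0, mul_one]
    _ = ψ t := by rw [← mul_assoc, hconst, one_mul]

/-- `γ` is a differentiable one-parameter group in `Sp(1,1)` with velocity `X`. -/
structure IsOneParam (γ : ℝ → Sp11) (X : sp11) : Prop where
  map_add : ∀ s t, γ (s + t) = γ s * γ t
  hasDerivAt : ∀ i j, HasDerivAt (fun t => (γ t).1.1 i j) (X.1 i j) 0

namespace IsOneParam

variable {γ : ℝ → Sp11} {X : sp11}

theorem map_zero (h : IsOneParam γ X) : γ 0 = 1 := by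
  have := h.map_add 0 0
  rw [add_zero] at this
  exact left_eq_mul.1 this

theorem map_neg (h : IsOneParam γ X) (t : ℝ) : γ (-t) = (γ t)⁻¹ := by
  rw [eq_inv_iff_mul_eq_one, ← h.map_add, neg_add_cancel, h.map_zero]

theorem continuous (h : IsOneParam γ X) : Continuous γ := by
  have h1 : Continuous fun t => (γ t).1.1 := by
    refine continuous_matrix fun i j => continuous_iff_continuousAt.2 fun t => ?_
    exact (hasDerivAt_of_add (φ := fun t => (γ t).1.1)
      (fun s t => by rw [h.map_add]; rfl) h.hasDerivAt t i j).continuousAt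
  have h2 : Continuous fun t => ((γ t)⁻¹).1.1 := by
    simp only [← h.map_neg]
    exact h1.comp continuous_neg
  have h3 : Continuous fun t => (γ t).1 := Units.continuous_iff.2 ⟨h1, h2⟩
  exact continuous_induced_rng.2 h3

end IsOneParam

/-! ### Boosts and rotations, which generate `Sp(1,1)`. -/

theorem exists_isOneParam (φ : ℝ → Matrix (Fin 2) (Fin 2) ℍ[ℝ]) (X : Matrix (Fin 2) (Fin 2) ℍ[ℝ])
    (hX : X ∈ sp11) (h0 : φ 0 = 1) (hadd : ∀ s t, φ (s + t) = φ s * φ t)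
    (hmem : ∀ t, (φ t)ᴴ * delta * φ t = delta)
    (hd : ∀ i j, HasDerivAt (fun t => φ t i j) (X i j) 0) :
    ∃ (γ : ℝ → Sp11) (X : sp11), IsOneParam γ X ∧ ∀ t, (γ t).1.1 = φ t :=
  ⟨fun t => ⟨⟨φ t, φ (-t), by rw [← hadd, add_neg_cancel, h0],
    by rw [← hadd, neg_add_cancel, h0]⟩, hmem t⟩, ⟨X, hX⟩,
    ⟨fun s t => Subtype.ext (Units.ext (hadd s t)), hd⟩, fun _ => rfl⟩

theorem delta_eq : delta = !![1, 0; 0, -1] := by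
  refine Matrix.ext fun i j => ?_
  fin_cases i <;> fin_cases j <;> simp [delta]

theorem hasDerivAt_smul_const {c : ℝ → ℝ} {c' t : ℝ} (hc : HasDerivAt c c' t) (q : ℍ[ℝ]) :
    HasDerivAt (fun s => c s • q) (c' • q) t := hc.smul_const q

/-- The one-parameter group of hyperbolic rotations with velocity `(0, n̄; n, 0)`. -/
theorem exists_boost {n : ℍ[ℝ]} (hn : star n * n = 1) (hn' : n * star n = 1) :
    ∃ (γ : ℝ → Sp11) (X : sp11), IsOneParam γ X ∧ ∀ t, (γ t).1.1 =
      !![Real.cosh t • 1, Real.sinh t • star n; Real.sinh t • n, Real.cosh t • 1] := by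
  refine exists_isOneParam _ !![0, star n; n, 0] ?_ ?_ ?_ ?_ ?_
  · rw [mem_sp11_iff]; simp
  · simp [Matrix.one_fin_two]
  · intro s t
    rw [Matrix.mul_fin_two]
    simp only [smul_mul_smul_comm, hn, hn', one_mul, mul_one, Real.cosh_add, Real.sinh_add]
    refine Matrix.ext fun i j => ?_
    fin_cases i <;> fin_cases j <;> simp <;> module
  · intro t
    have hc : !![Real.cosh t • (1 : ℍ[ℝ]), Real.sinh t • star n;
        Real.sinh t • n, Real.cosh t • 1]ᴴ =
        !![Real.cosh t • (1 : ℍ[ℝ]), Real.sinh t • star n;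
          Real.sinh t • n, Real.cosh t • 1] := by
      refine Matrix.ext fun i j => ?_
      fin_cases i <;> fin_cases j <;> simp [Matrix.conjTranspose_apply, Quaternion.star_smul]
    have h := Real.cosh_sq t
    rw [hc, delta_eq, Matrix.mul_fin_two, Matrix.mul_fin_two]
    simp only [mul_zero, zero_add, add_zero, mul_one, mul_neg, neg_mul, smul_mul_smul_comm,
      hn, hn', one_mul]
    have h1 : Real.cosh t * Real.cosh t = Real.sinh t * Real.sinh t + 1 := by
      rw [← sq, ← sq, h]
    refine Matrix.ext fun i j => ?_
    fin_cases i <;> fin_cases j <;> simp [h1] <;> module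
  · intro i j
    have hc := hasDerivAt_smul_const (Real.hasDerivAt_cosh 0) (1 : ℍ[ℝ])
    have hs := fun q : ℍ[ℝ] => hasDerivAt_smul_const (Real.hasDerivAt_sinh 0) q
    simp only [Real.sinh_zero, Real.cosh_zero, zero_smul, one_smul] at hc hs
    fin_cases i <;> fin_cases j
    · exact hc
    · exact hs _
    · exact hs _
    · exact hc

theorem rot_mul {n : ℍ[ℝ]} (hn : n * n = -1) (s t : ℝ) :
    Real.cos (s + t) • 1 + Real.sin (s + t) • n =
      (Real.cos s • 1 + Real.sin s • n) * (Real.cos t • 1 + Real.sin t • n) := by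
  simp only [mul_add, add_mul, smul_mul_smul_comm, hn, one_mul, mul_one, Real.cos_add,
    Real.sin_add]
  module

theorem star_rot_mul {n : ℍ[ℝ]} (hn : n * n = -1) (hs : star n = -n) (t : ℝ) :
    star (Real.cos t • 1 + Real.sin t • n) * (Real.cos t • 1 + Real.sin t • n) = 1 := by
  have h : star (Real.cos t • 1 + Real.sin t • n) = Real.cos (-t) • 1 + Real.sin (-t) • n := by
    simp [Quaternion.star_smul, hs]
  rw [h, ← rot_mul hn]
  simp

theorem hasDerivAt_rot (n : ℍ[ℝ]) :
    HasDerivAt (fun t => Real.cos t • 1 + Real.sin t • n) n 0 := by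
  have h := (hasDerivAt_smul_const (Real.hasDerivAt_cos 0) (1 : ℍ[ℝ])).add
    (hasDerivAt_smul_const (Real.hasDerivAt_sin 0) n)
  rw [Real.sin_zero, Real.cos_zero, neg_zero, zero_smul, one_smul, zero_add] at h
  exact h

/-- The one-parameter group of rotations of the first coordinate. -/
theorem exists_rot_left {n : ℍ[ℝ]} (hn : n * n = -1) (hs : star n = -n) :
    ∃ (γ : ℝ → Sp11) (X : sp11), IsOneParam γ X ∧ ∀ t, (γ t).1.1 =
      !![Real.cos t • 1 + Real.sin t • n, 0; 0, 1] := by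
  refine exists_isOneParam _ !![n, 0; 0, 0] ?_ ?_ ?_ ?_ ?_
  · rw [mem_sp11_iff]; simpa using Quaternion.star_eq_neg.1 hs
  · simp [Matrix.one_fin_two]
  · intro s t
    rw [Matrix.mul_fin_two, rot_mul hn]
    simp
  · intro t
    have h := star_rot_mul hn hs t
    generalize Real.cos t • 1 + Real.sin t • n = p at h
    have hc : !![p, 0; 0, (1 : ℍ[ℝ])]ᴴ = !![star p, 0; 0, 1] := by
      refine Matrix.ext fun i j => ?_
      fin_cases i <;> fin_cases j <;> simp [Matrix.conjTranspose_apply]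
    rw [hc, delta_eq, Matrix.mul_fin_two, Matrix.mul_fin_two]
    simp [h]
  · intro i j
    fin_cases i <;> fin_cases j
    · exact hasDerivAt_rot n
    · exact hasDerivAt_const _ _
    · exact hasDerivAt_const _ _
    · exact hasDerivAt_const _ _

/-- The one-parameter group of rotations of the second coordinate. -/
theorem exists_rot_right {n : ℍ[ℝ]} (hn : n * n = -1) (hs : star n = -n) :
    ∃ (γ : ℝ → Sp11) (X : sp11), IsOneParam γ X ∧ ∀ t, (γ t).1.1 =
      !![1, 0; 0, Real.cos t • 1 + Real.sin t • n] := by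
  refine exists_isOneParam _ !![0, 0; 0, n] ?_ ?_ ?_ ?_ ?_
  · rw [mem_sp11_iff]; simpa using Quaternion.star_eq_neg.1 hs
  · simp [Matrix.one_fin_two]
  · intro s t
    rw [Matrix.mul_fin_two, rot_mul hn]
    simp
  · intro t
    have h := star_rot_mul hn hs t
    generalize Real.cos t • 1 + Real.sin t • n = p at h
    have hc : !![(1 : ℍ[ℝ]), 0; 0, p]ᴴ = !![1, 0; 0, star p] := by
      refine Matrix.ext fun i j => ?_
      fin_cases i <;> fin_cases j <;> simp [Matrix.conjTranspose_apply]
    rw [hc, delta_eq, Matrix.mul_fin_two, Matrix.mul_fin_two]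
    simp [h]
  · intro i j
    fin_cases i <;> fin_cases j
    · exact hasDerivAt_const _ _
    · exact hasDerivAt_const _ _
    · exact hasDerivAt_const _ _
    · exact hasDerivAt_rot n

/-- A unit quaternion is `cos t + n sin t` with `n` an imaginary unit. -/
theorem exists_rot_eq {p : ℍ[ℝ]} (hp : Quaternion.normSq p = 1) :
    ∃ (n : ℍ[ℝ]) (t : ℝ), n * n = -1 ∧ star n = -n ∧ p = Real.cos t • 1 + Real.sin t • n := by
  have him : ∀ n : ℍ[ℝ], n.re = 0 → n.imI ^ 2 + n.imJ ^ 2 + n.imK ^ 2 = 1 → n * n = -1 := by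
    intro n h0 h1
    ext <;> simp [h0] <;> linarith
  rw [Quaternion.normSq_def'] at hp
  have hsin : Real.sin (Real.arccos p.re) ^ 2 = p.imI ^ 2 + p.imJ ^ 2 + p.imK ^ 2 := by
    rw [Real.sin_sq, Real.cos_arccos (by nlinarith) (by nlinarith)]
    linarith
  have hcos : Real.cos (Real.arccos p.re) = p.re :=
    Real.cos_arccos (by nlinarith) (by nlinarith)
  set t := Real.arccos p.re
  by_cases h : Real.sin t = 0
  · rw [h] at hsin
    -- Here `p` is real, so any imaginary unit serves; `i` is taken.
    let n : ℍ[ℝ] := ofCoords ![0, 1, 0, 0]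
    refine ⟨n, t, him n rfl (by simp [n]), Quaternion.star_eq_neg.2 rfl, ?_⟩
    rw [h, hcos]
    ext <;> simp <;> nlinarith
  · let n : ℍ[ℝ] := (Real.sin t)⁻¹ • (p - (p.re : ℍ[ℝ]))
    refine ⟨n, t, him n (by simp [n]) ?_, Quaternion.star_eq_neg.2 (by simp [n]), ?_⟩
    · simp only [n, Quaternion.imI_smul, Quaternion.imJ_smul, Quaternion.imK_smul,
        Quaternion.imI_sub, Quaternion.imJ_sub, Quaternion.imK_sub, Quaternion.imI_coe,
        Quaternion.imJ_coe, Quaternion.imK_coe, smul_eq_mul, sub_zero]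
      field_simp
      linarith
    · simp only [n]
      rw [smul_smul, mul_inv_cancel₀ h, one_smul, hcos]
      ext <;> simp

/-- The one-parameter groups generate `Sp(1,1)`. -/
theorem eq_top_of_isOneParam_mem (H : Subgroup Sp11)
    (hH : ∀ γ X, IsOneParam γ X → ∀ t, γ t ∈ H) : H = ⊤ := by
  -- If `C = 0`, the relations give `|A| = 1`, then `B = 0`, then `|D| = 1`. So `g` is a product of
  -- a left and a right rotation.
  have hdiag : ∀ g : Sp11, g.1.1 1 0 = 0 → g ∈ H := by
    intro g hg
    obtain ⟨h0, h1, h2⟩ := entries_of_mem_Sp11 g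
    rw [hg, mul_zero, sub_zero] at h0
    have ha : g.1.1 0 0 ≠ 0 := by rintro h; simp [h] at h0
    have hb : g.1.1 0 1 = 0 := by
      simpa [hg, ha] using h1
    rw [hb, mul_zero, zero_sub, neg_inj] at h2
    rw [Quaternion.star_mul_self] at h0 h2
    obtain ⟨n, s, hn, hns, hs⟩ := exists_rot_eq (p := g.1.1 0 0)
      (Quaternion.coe_injective h0)
    obtain ⟨m, t, hm, hmt, ht⟩ := exists_rot_eq (p := g.1.1 1 1)
      (Quaternion.coe_injective h2)
    obtain ⟨γ, X, hγ, e⟩ := exists_rot_left hn hns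
    obtain ⟨γ', X', hγ', e'⟩ := exists_rot_right hm hmt
    have hg : g = γ s * γ' t := by
      refine Subtype.ext (Units.ext ?_)
      change g.1.1 = (γ s).1.1 * (γ' t).1.1
      rw [e, e', ← hs, ← ht, Matrix.mul_fin_two, Matrix.eta_fin_two g.1.1, hb, hg]
      simp
    rw [hg]
    exact H.mul_mem (hH _ _ hγ _) (hH _ _ hγ' _)
  refine eq_top_iff.2 fun g _ => ?_
  by_cases hc : g.1.1 1 0 = 0
  · exact hdiag g hc
  obtain ⟨h0, -, -⟩ := entries_of_mem_Sp11 g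
  set a := g.1.1 0 0
  set c := g.1.1 1 0
  rw [Quaternion.star_mul_self, Quaternion.star_mul_self, Quaternion.normSq_eq_norm_mul_self,
    Quaternion.normSq_eq_norm_mul_self] at h0
  have h1 : ‖a‖ * ‖a‖ - ‖c‖ * ‖c‖ = 1 :=
    Quaternion.coe_injective (by rw [Quaternion.coe_sub, h0, Quaternion.coe_one])
  have hc' : 0 < ‖c‖ := norm_pos_iff.2 hc
  have ha' : 0 < ‖a‖ := (norm_nonneg a).lt_of_ne fun h => by rw [← h] at h1; nlinarith
  have ha : a ≠ 0 := norm_pos_iff.1 ha'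
  -- A boost is sought that clears the lower left entry: `cosh t · c = sinh t · n a`. Since `|a|² -
  -- |c|² = 1`, one can take `sinh t = |c|` and `cosh t = |a|`, and solving for `n` gives a unit
  -- quaternion.
  let n : ℍ[ℝ] := (‖a‖ / ‖c‖) • (c * a⁻¹)
  have hnn : ‖n‖ = 1 := by
    simp only [n, norm_smul, norm_mul, norm_inv, norm_div, norm_norm]
    field_simp
  have hN : Quaternion.normSq n = 1 := by rw [Quaternion.normSq_eq_norm_mul_self, hnn, one_mul]
  have hna : ‖c‖ • (n * a) = ‖a‖ • c := by
    simp only [n]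
    rw [smul_mul_assoc, smul_smul, mul_div_cancel₀ _ hc'.ne', mul_assoc, inv_mul_cancel₀ ha,
      mul_one]
  obtain ⟨γ, X, hγ, e⟩ := exists_boost (n := n)
    (by rw [Quaternion.star_mul_self, hN]; simp) (by rw [Quaternion.self_mul_star, hN]; simp)
  set t := Real.arsinh ‖c‖
  have hs : Real.sinh t = ‖c‖ := Real.sinh_arsinh _
  have hch : Real.cosh t = ‖a‖ := by
    rw [Real.cosh_arsinh, ← Real.sqrt_mul_self ha'.le]
    congr 1
    linarith
  have h2 : γ (-t) * g ∈ H := by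
    apply hdiag
    change ((γ (-t)).1.1 * g.1.1) 1 0 = 0
    rw [e, Matrix.mul_apply, Fin.sum_univ_two]
    simp only [Real.sinh_neg, Real.cosh_neg, hs, hch]
    change (-‖c‖ • n) * a + (‖a‖ • (1 : ℍ[ℝ])) * c = 0
    rw [smul_mul_assoc, neg_smul, hna, smul_mul_assoc, one_mul, neg_add_cancel]
  exact (H.mul_mem_cancel_left (hH γ X hγ (-t))).1 h2

/-! ### The covering morphism and its uniqueness. -/

theorem spinHom_mem_Oo14 (g : Sp11) : spinHom g ∈ Oo14 := by
  have h : Oo14.comap spinHom = ⊤ := by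
    refine eq_top_of_isOneParam_mem _ fun γ X hγ t => ?_
    change spinHom (γ t) ∈ connectedComponent (1 : O14)
    have hc : Continuous fun t => spinHom (γ t) := continuous_spinHom.comp hγ.continuous
    -- The image of a one-parameter group is connected and contains `1`, at parameter `0`.
    refine (isPreconnected_range hc).subset_connectedComponent ⟨0, ?_⟩ ⟨t, rfl⟩
    simp only [hγ.map_zero, map_one]
  exact (Subgroup.eq_top_iff' _).1 h g

/-- The spin covering `Sp(1,1) → O_o(1,4)`. -/
def spinCover : Sp11 →* Oo14 := spinHom.codRestrict Oo14 spinHom_mem_Oo14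

theorem integrates_spinCover : Integrates spinCover fEquiv := by
  refine ⟨continuous_induced_rng.2 continuous_spinHom, fun γ X h0 hγ i j => ?_⟩
  exact hasDerivAt_spinMatrix X.2 (A := fun t => (γ t).1.1) (by rw [h0]; rfl) hγ i j

/-- The set where `F` and `G` agree is a subgroup. It contains every one-parameter group `γ`,
because `F ∘ γ` and `G ∘ γ` are one-parameter matrix groups with the same velocity `f X`. -/
theorem integrates_unique {F G : Sp11 →* Oo14} {f : sp11 → o14} (hF : Integrates F f)
    (hG : Integrates G f) : F = G := by
  have h : F.eqLocus G = ⊤ := by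
    refine eq_top_of_isOneParam_mem _ fun γ X hγ t => ?_
    have hadd : ∀ (K : Sp11 →* Oo14) (s t : ℝ),
        (K (γ (s + t))).1.1.1 = (K (γ s)).1.1.1 * (K (γ t)).1.1.1 := fun K s t => by
      rw [hγ.map_add, map_mul]; rfl
    have hone : ∀ K : Sp11 →* Oo14, (K (γ 0)).1.1.1 = 1 := fun K => by
      rw [hγ.map_zero, map_one]; rfl
    have := oneParam_unique (hadd F) (hadd G) (hone F) (hone G)
      (hF.2 γ X hγ.map_zero hγ.hasDerivAt) (hG.2 γ X hγ.map_zero hγ.hasDerivAt)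
    exact Subtype.ext (Subtype.ext (Units.ext (congrFun this t)))
  exact MonoidHom.ext fun g => (Subgroup.eq_top_iff' _).1 h g

end SpinConf

end

theorem proposition6p3 :
    ∃ f : SpinConf.sp11 ≃ₗ⁅ℝ⁆ SpinConf.o14,
      (∀ X : SpinConf.sp11,
        ((f X : SpinConf.o14) : Matrix (Fin 1 ⊕ Fin 4) (Fin 1 ⊕ Fin 4) ℝ) =
          SpinConf.fMatrix (X : Matrix (Fin 2) (Fin 2) (Quaternion ℝ))) ∧
      (∃! F : SpinConf.Sp11 →* SpinConf.Oo14, SpinConf.Integrates F f) ∧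
      ∀ F : SpinConf.Sp11 →* SpinConf.Oo14, SpinConf.Integrates F f →
        ∀ (g : SpinConf.Sp11) (u : SpinConf.Sp1),
          SpinConf.conformalAct (F g) (SpinConf.rho u) =
            SpinConf.rho (SpinConf.mobiusAct g u) := by
  refine ⟨SpinConf.fEquiv, fun _ => rfl, ⟨SpinConf.spinCover, SpinConf.integrates_spinCover,
    fun F hF => SpinConf.integrates_unique hF SpinConf.integrates_spinCover⟩, fun F hF g u => ?_⟩
  rw [SpinConf.integrates_unique hF SpinConf.integrates_spinCover]
  exact SpinConf.conformalAct_spinHom g u
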